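/- Let $\mathsf h$ be a separable complex Hilbert space and let $\mathsf{tr}$ be the trace. A quantum Markov semigroup (QMS) on $\mathcal B(\mathsf h)$ is a $\sigma$-weakly continuous semigroup $(\mathcal T_t)_{t\ge 0}$ of normal, completely positive, identity preserving maps on $\mathcal B(\mathsf h)$, with $\mathcal T_0=\mathrm{id}$; it is uniformly continuous if $\|\mathcal T_t-\mathrm{id}\|\to 0$ as $t\to0$, and then its generator $\mathcal L=\lim_{t\to 0^+}(\mathcal T_t-\mathrm{id})/t$ (norm limit) is bounded. Let $\theta$ be an anti-unitary operator on $\mathsf h$ with $\theta^2=1$, and let $\Theta(x)=\theta x^*\theta$ be the associated reversing operation on $\mathcal B(\mathsf h)$. Let $\mathcal T=(\mathcal T_t)_{t\ge 0}$ be a uniformly continuous QMS on $\mathcal B(\mathsf h)$ with generator $\mathcal L$ and with a faithful normal invariant state of density $\rho$, that is, $\rho\ge0$, $\mathsf{tr}(\rho)=1$, $\mathsf{tr}(\rho\,\mathcal T_t(x))=\mathsf{tr}(\rho x)$ for all $t\ge 0$ and $x\in\mathcal B(\mathsf h)$, and $x\geq 0$, $\mathsf{tr}(\rho x)=0$ imply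 $x=0$. A special GKSL representation of $\mathcal L$ consists of $H=H^*\in\mathcal B(\mathsf h)$ and a finite or countable family $(L_k)_k$ in $\mathcal B(\mathsf h)$ such that $\sum_k L_k^*L_k$ converges in norm, $\mathsf{tr}(\rho L_k)=0$ for all $k$, the conditions $\sum_k|c_k|^2<\infty$ and $c_0 1+\sum_k c_kL_k=0$ imply that $c_0=0$ and all $c_k=0$, and $$\mathcal L(x)=i[H,x]-\tfrac12\sum_k\left(L_k^*L_kx-2L_k^*xL_k+xL_k^*L_k\right),\qquad x\in\mathcal B(\mathsf h).$$ Assume that $\mathcal T$ satisfies a weighted detailed balance condition: there are a linear map $\mathcal L'$ on $\mathcal B(\mathsf h)$ that is KMS adjoint to $\mathcal L$, i.e. $$\mathsf{tr}\big(\rho^{1/2}x\rho^{1/2}\mathcal L(y)\big)=\mathsf{tr}\big(\rho^{1/2}\mathcal L'(x)\rho^{1/2}y\big),\qquad x,y\in\mathcal B(\mathsf h),$$ a special GKSL representation $(H,(L_k)_k)$ of $\mathcal L$, weights $q_k>0$ and a bounded operator $K=K^*$ such that $$\mathcal L'(x)-\mathcal L(x)=-2i[K,x]+\sum_k(q_k-1)L_k^*xL_k,\qquad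 x\in\mathcal B(\mathsf h),$$ where the series converges strongly. Then: 1. there is a unique QMS $\mathcal T'=(\mathcal T'_t)_{t\ge0}$ (the KMS adjoint) with $\mathsf{tr}(\rho^{1/2}x\rho^{1/2}\mathcal T_t(y))=\mathsf{tr}(\rho^{1/2}\mathcal T'_t(x)\rho^{1/2}y)$ for all $t\ge0$ and $x,y\in\mathcal B(\mathsf h)$; 2. there is a unique QMS $\mathcal T^\Theta=(\mathcal T^\Theta_t)_{t\ge0}$ (the $\Theta$-KMS adjoint) with $$\mathsf{tr}\big(\rho^{1/2}\Theta(x^*)\rho^{1/2}\mathcal T_t(y)\big)=\mathsf{tr}\big(\rho^{1/2}\Theta(\mathcal T^\Theta_t(x^*))\rho^{1/2}y\big)$$ for all $t\ge0$ and $x,y\in\mathcal B(\mathsf h)$; 3. $\mathcal T^\Theta_t=\Theta\circ\mathcal T'_t\circ\Theta$ for all $t\ge 0$, and $\mathcal T^\Theta$ is uniformly continuous. -/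

import Mathlib

open Filter Topology
open scoped NNReal InnerProductSpace CStarAlgebra ComplexConjugate

noncomputable section

namespace KMS

/-- The algebra `B(h)` of bounded operators on `h`, with Mathlib's C⋆-algebra structure and its
Loewner order. -/
abbrev BOp (h : Type*) [NormedAddCommGroup h] [InnerProductSpace ℂ h] : Type _ := h →L[ℂ] h

/-- An anti-unitary operator, that is, a surjective conjugate-linear isometry, satisfies
`⟨θ u, θ v⟩ = ⟨v, u⟩`. -/
theorem antiunitary_inner {h : Type*} [NormedAddCommGroup h] [InnerProductSpace ℂ h]
    (θ : h ≃ₗᵢ⋆[ℂ] h) (u v : h) : ⟪θ u, θ v⟫_ℂ = ⟪v, u⟫_ℂ := by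
  have key : ∀ a b : h, ‖a + b‖ ^ 2 = ‖a‖ ^ 2 + 2 * RCLike.re ⟪a, b⟫_ℂ + ‖b‖ ^ 2 :=
    fun a b => norm_add_sq a b
  have hre : ∀ a b : h, RCLike.re ⟪θ a, θ b⟫_ℂ = RCLike.re ⟪a, b⟫_ℂ := by
    intro a b
    have h1 := key (θ a) (θ b)
    rw [← map_add, θ.norm_map, θ.norm_map, θ.norm_map, key a b] at h1
    linarith
  have h1 := hre u v
  have h2 := hre (Complex.I • u) v
  rw [θ.map_smulₛₗ, inner_smul_left, inner_smul_left] at h2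
  have h3 : ⟪v, u⟫_ℂ = conj ⟪u, v⟫_ℂ := (inner_conj_symm v u).symm
  rw [h3]
  apply Complex.ext
  · rw [Complex.conj_re]
    exact h1
  · simp at h2
    rw [Complex.conj_im]
    linarith

section HilbertSpace

variable {h : Type*} [NormedAddCommGroup h] [InnerProductSpace ℂ h] [CompleteSpace h]

/-! ### Trace and states -/

/-- The index set of a (fixed) orthonormal basis of `h`. -/
def onbIndex (h : Type*) [NormedAddCommGroup h] [InnerProductSpace ℂ h] [CompleteSpace h] : Set h :=
  Classical.choose (exists_hilbertBasis ℂ h)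

/-- A (fixed) orthonormal basis of `h`. -/
def onb (h : Type*) [NormedAddCommGroup h] [InnerProductSpace ℂ h] [CompleteSpace h] :
    HilbertBasis (onbIndex h) ℂ h :=
  Classical.choose (Classical.choose_spec (exists_hilbertBasis ℂ h))

/-- The trace of a trace class operator, `tr A = ∑ᵢ ⟨eᵢ, A eᵢ⟩`; for trace class operators the series
converges absolutely and does not depend on the orthonormal basis. It is only applied below to
products that contain a state `ρ`, or its square root `ρ^{1/2}` (a Hilbert-Schmidt operator) twice,
and all of these are trace class. -/
def opTrace (A : BOp h) : ℂ := ∑' i, ⟪onb h i, A (onb h i)⟫_ℂ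

/-- `ρ` is (the density of) a normal state: a positive operator of trace one. -/
structure IsState (ρ : BOp h) : Prop where
  nonneg : 0 ≤ ρ
  trace_one : HasSum (fun i => ⟪onb h i, ρ (onb h i)⟫_ℂ) 1

/-- The state `x ↦ tr (ρ x)` is faithful. -/
def IsFaithful (ρ : BOp h) : Prop :=
  ∀ x : BOp h, 0 ≤ x → opTrace (ρ * x) = 0 → x = 0

/-! ### Quantum Markov semigroups -/

/-- A family of bounded linear maps on `B(h)` is a quantum Markov semigroup: a σ-weakly continuous
semigroup of normal, completely positive, identity preserving maps. The σ-weakly continuous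
functionals are `x ↦ ∑ₙ ⟨uₙ, x vₙ⟩` with `∑ₙ ‖uₙ‖² < ∞` and `∑ₙ ‖vₙ‖² < ∞`. Normality means that
suprema of increasing nets are preserved; this is Mathlib's `ScottContinuous`. -/
structure IsQMS (T : ℝ≥0 → (BOp h →L[ℂ] BOp h)) : Prop where
  map_zero : T 0 = ContinuousLinearMap.id ℂ (BOp h)
  map_add : ∀ s t, T (s + t) = (T s).comp (T t)
  map_one : ∀ t, T t 1 = 1
  completelyPositive : ∀ t, ∃ φ : BOp h →CP BOp h, ∀ x, φ x = T t x
  normal : ∀ t, ScottContinuous (fun x : BOp h => T t x)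
  weakContinuous : ∀ (x : BOp h) (u v : ℕ → h),
    Summable (fun n => ‖u n‖ ^ 2) → Summable (fun n => ‖v n‖ ^ 2) →
    Continuous (fun t : ℝ≥0 => ∑' n, ⟪u n, T t x (v n)⟫_ℂ)

/-- Uniform continuity: `‖T_t - id‖ → 0` as `t → 0`. -/
def IsUniformlyContinuous (T : ℝ≥0 → (BOp h →L[ℂ] BOp h)) : Prop :=
  Tendsto (fun t => ‖T t - ContinuousLinearMap.id ℂ (BOp h)‖) (𝓝 0) (𝓝 0)

/-- The state `ρ` is invariant: `tr (ρ T_t(x)) = tr (ρ x)`. -/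
def IsInvariant (ρ : BOp h) (T : ℝ≥0 → (BOp h →L[ℂ] BOp h)) : Prop :=
  ∀ t x, opTrace (ρ * T t x) = opTrace (ρ * x)

/-- `L` is the (bounded) generator of `T`: the norm limit of `(T_t - id) / t` as `t → 0`, `t > 0`. -/
def IsGenerator (T : ℝ≥0 → (BOp h →L[ℂ] BOp h)) (L : BOp h →L[ℂ] BOp h) : Prop :=
  Tendsto (fun t : ℝ≥0 => ((t : ℝ) : ℂ)⁻¹ • (T t - ContinuousLinearMap.id ℂ (BOp h)))
    (𝓝[>] 0) (𝓝 L)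

/-! ### The KMS adjoint -/

/-- `Φ'` is adjoint to `Φ` for the KMS form of `ρ`:
`tr (ρ^{1/2} x ρ^{1/2} Φ(y)) = tr (ρ^{1/2} Φ'(x) ρ^{1/2} y)`. -/
def IsKMSAdjointMap (ρ : BOp h) (Φ Φ' : BOp h → BOp h) : Prop :=
  ∀ x y : BOp h, opTrace (CFC.sqrt ρ * x * CFC.sqrt ρ * Φ y) =
    opTrace (CFC.sqrt ρ * Φ' x * CFC.sqrt ρ * y)

/-- `T'` is a KMS adjoint quantum Markov semigroup of `T`. -/
structure IsKMSAdjointQMS (ρ : BOp h) (T T' : ℝ≥0 → (BOp h →L[ℂ] BOp h)) : Prop where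
  isQMS : IsQMS T'
  duality : ∀ t, IsKMSAdjointMap ρ (T t) (T' t)

/-! ### Reversing operations and the Θ-KMS adjoint -/

/-- The reversing operation `Θ(x) = θ x* θ` of an anti-unitary operator `θ`. -/
def reversing (θ : h ≃ₗᵢ⋆[ℂ] h) (x : BOp h) : BOp h :=
  (θ.toContinuousLinearEquiv : h →L⋆[ℂ] h).comp
    ((star x).comp (θ.toContinuousLinearEquiv : h →L⋆[ℂ] h))

theorem reversing_apply (θ : h ≃ₗᵢ⋆[ℂ] h) (x : BOp h) (u : h) :
    reversing θ x u = θ (star x (θ u)) := rfl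

/-- `S` is a Θ-KMS adjoint of `T` with respect to `ρ`: a quantum Markov semigroup with
`tr (ρ^{1/2} Θ(x*) ρ^{1/2} T_t(y)) = tr (ρ^{1/2} Θ(S_t(x*)) ρ^{1/2} y)`. -/
structure IsThetaKMSAdjointQMS (θ : h ≃ₗᵢ⋆[ℂ] h) (ρ : BOp h)
    (T S : ℝ≥0 → (BOp h →L[ℂ] BOp h)) : Prop where
  isQMS : IsQMS S
  duality : ∀ (t : ℝ≥0) (x y : BOp h),
    opTrace (CFC.sqrt ρ * reversing θ (star x) * CFC.sqrt ρ * T t y) =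
      opTrace (CFC.sqrt ρ * reversing θ (S t (star x)) * CFC.sqrt ρ * y)

/-! ### Weighted detailed balance -/

/-- `(H, (L_k))` is a special GKSL representation of the generator `𝓛` with respect to `ρ`:
`H` is self-adjoint, `∑ L_k* L_k` converges in norm,
`𝓛(x) = i[H,x] - ½ ∑ (L_k* L_k x - 2 L_k* x L_k + x L_k* L_k)`, all `tr (ρ L_k)` vanish, and
`1, L_1, L_2, …` are independent for square summable coefficients. -/
structure IsSpecialGKSL (ρ : BOp h) (𝓛 : BOp h →L[ℂ] BOp h) {ι : Type} (H : BOp h)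
    (L : ι → BOp h) : Prop where
  selfAdjoint : IsSelfAdjoint H
  summable : Summable (fun k => star (L k) * L k)
  representation : ∀ x : BOp h,
    HasSum (fun k => star (L k) * L k * x - 2 • (star (L k) * x * L k) + x * (star (L k) * L k))
      ((2 : ℂ) • (Complex.I • (H * x - x * H) - 𝓛 x))
  trace_zero : ∀ k, opTrace (ρ * L k) = 0
  independent : ∀ (c₀ : ℂ) (c : ι → ℂ), Summable (fun k => ‖c k‖ ^ 2) →
    HasSum (fun k => c k • L k) (-(c₀ • (1 : BOp h))) → c₀ = 0 ∧ ∀ k, c k = 0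

/-- The weighted detailed balance condition for the semigroup `T` and the state `ρ`: with `𝓛` the
generator of `T` and `𝓛'` its KMS adjoint, `𝓛' - 𝓛 = -2i[K, ·] + Π` where
`Π(x) = ∑ (q_k - 1) L_k* x L_k` (the series being strongly convergent), `K` is bounded and
self-adjoint, `q_k > 0`, and the bounded operators `L_k` belong to a special GKSL representation
of `𝓛`. -/
def WeightedDetailedBalance (ρ : BOp h) (T : ℝ≥0 → (BOp h →L[ℂ] BOp h)) : Prop :=
  ∃ (𝓛 : BOp h →L[ℂ] BOp h) (𝓛' : BOp h →ₗ[ℂ] BOp h),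
    IsGenerator T 𝓛 ∧ IsKMSAdjointMap ρ 𝓛 𝓛' ∧
    ∃ (ι : Type) (_ : Countable ι) (H : BOp h) (L : ι → BOp h) (q : ι → ℝ) (K : BOp h),
      IsSpecialGKSL ρ 𝓛 H L ∧ (∀ k, 0 < q k) ∧ IsSelfAdjoint K ∧
      ∀ (x : BOp h) (u : h),
        HasSum (fun k => ((q k - 1 : ℝ) : ℂ) • (star (L k) * x * L k) u)
          ((𝓛' x - 𝓛 x + (2 * Complex.I) • (K * x - x * K)) u)

end HilbertSpace

end KMS

end

/-!
Write `s = ρ^{1/2}`. This is a self-adjoint Hilbert-Schmidt operator with dense range, so the KMS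
form `B(x, y) = tr (s x s y)` (`kmsForm`) is symmetric, norm continuous in each variable and
separates points, the latter because `B(x, |v⟩⟨u|) = ⟨s u, x s v⟩`. Uniqueness of
both adjoint semigroups is this separation of points.

For existence, detailed balance provides an everywhere defined linear map `𝓛'` which is adjoint to
the generator `𝓛` for `B`, so that its graph is closed and it is bounded
(`continuous_of_kmsAdjoint`). Since `T_t = exp (t 𝓛)` (`semigroup_eq_exp`), the uniformly continuous
semigroup `T'_t = exp (t 𝓛')` is in duality with `T` (`kmsForm_exp`). The other properties of a
quantum Markov semigroup pass from `T` to `T'` by duality (`isQMS_of_kmsAdjoint`):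

* `T'_t 1 = 1` is the invariance of `ρ`, as `B(1, y) = tr (ρ y)`;
* complete positivity holds because positivity of a matrix `X` amounts to
  `∑ᵢⱼ B(Xᵢⱼ, Yⱼᵢ) ≥ 0` for all positive matrices `Y` (`sum_kmsForm_nonneg` and
  `cstarMatrix_nonneg_of_forall_kmsForm_nonneg`);
* normality holds because `B(·, y)` is continuous along increasing nets, by Vigier's theorem
  (`tendsto_apply_of_isLUB`) and dominated convergence.

The reversing operation `Θ` is an isometric, involutive, order preserving linear map, and
`x ↦ Θ(x*)` is a conjugate-linear multiplicative one. Hence `Θ ∘ T'_t ∘ Θ` is again a quantum Markov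
semigroup (`IsQMS.conj_reversing`), it is uniformly continuous with `T'`, and it is the Θ-KMS
adjoint because `Θ ∘ Θ = id`.
-/

/-! ### Uniformly continuous semigroups -/

section Semigroup

theorem exp_semigroup_zero {𝔸 : Type*} [NormedRing 𝔸] [NormedAlgebra ℂ 𝔸] (L : 𝔸) :
    NormedSpace.exp ((((0 : ℝ≥0) : ℝ) : ℂ) • L) = 1 := by
  rw [NNReal.coe_zero, Complex.ofReal_zero, zero_smul, NormedSpace.exp_zero]

variable {𝔸 : Type*} [NormedRing 𝔸] [CompleteSpace 𝔸]

/-- Near `t`, `T_x = T_{t-x}⁻¹ T_{x-t} T_t` with truncated differences, one of which vanishes. -/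
theorem continuous_of_semigroup {T : ℝ≥0 → 𝔸} (h0 : T 0 = 1) (hadd : ∀ s t, T (s + t) = T s * T t)
    (hc : Tendsto T (𝓝 0) (𝓝 1)) : Continuous T := by
  refine continuous_iff_continuousAt.2 fun t => ?_
  have hl : Tendsto (fun x => T (t - x)) (𝓝 t) (𝓝 1) := by
    refine hc.comp ?_
    have : Tendsto (fun x => t - x) (𝓝 t) (𝓝 (t - t)) := (continuous_sub_left t).tendsto t
    rwa [tsub_self] at this
  have hr : Tendsto (fun x => T (x - t)) (𝓝 t) (𝓝 1) := by
    refine hc.comp ?_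
    have : Tendsto (fun x => x - t) (𝓝 t) (𝓝 (t - t)) := (continuous_sub_right t).tendsto t
    rwa [tsub_self] at this
  have hinv : Tendsto (fun x => Ring.inverse (T (t - x))) (𝓝 t) (𝓝 1) := by
    have := (NormedRing.inverse_continuousAt (1 : 𝔸ˣ)).tendsto.comp hl
    rwa [Units.val_one, Ring.inverse_one] at this
  have hlim := (hinv.mul hr).mul_const (T t)
  rw [one_mul, one_mul] at hlim
  refine hlim.congr' ?_
  have hunit : ∀ᶠ x in 𝓝 t, IsUnit (T (t - x)) :=
    hl.eventually (Units.isOpen.mem_nhds isUnit_one)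
  filter_upwards [hunit] with x hx
  rcases le_total t x with h | h
  · rw [tsub_eq_zero_of_le h, h0, Ring.inverse_one, one_mul, ← hadd, tsub_add_cancel_of_le h]
  · rw [tsub_eq_zero_of_le h, h0, mul_one]
    nth_rw 2 [← tsub_add_cancel_of_le h]
    rw [hadd, Ring.inverse_mul_cancel_left _ _ hx]

/-- `T` and the exponential solve the same linear equation `f' = L f` from the right. -/
theorem semigroup_eq_exp [NormedAlgebra ℂ 𝔸] {T : ℝ≥0 → 𝔸} {L : 𝔸} (h0 : T 0 = 1)
    (hadd : ∀ s t, T (s + t) = T s * T t) (hc : Tendsto T (𝓝 0) (𝓝 1))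
    (hL : Tendsto (fun t : ℝ≥0 => ((t : ℝ) : ℂ)⁻¹ • (T t - 1)) (𝓝[>] 0) (𝓝 L)) (t : ℝ≥0) :
    T t = NormedSpace.exp (((t : ℝ) : ℂ) • L) := by
  have hTc := continuous_of_semigroup h0 hadd hc
  have hexp : ∀ r : ℝ, HasDerivAt (fun u : ℝ => NormedSpace.exp (u • L))
      (L * NormedSpace.exp (r • L)) r := fun r => hasDerivAt_exp_smul_const' L r
  have hderiv : ∀ r : ℝ, 0 ≤ r →
      HasDerivWithinAt (fun u : ℝ => T u.toNNReal) (L * T r.toNNReal) (Set.Ici r) r := by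
    intro r hr
    rw [hasDerivWithinAt_iff_tendsto_slope, Set.Ici_sdiff_left]
    have h1 : Tendsto (fun x : ℝ => (x - r).toNNReal) (𝓝[>] r) (𝓝[>] 0) := by
      refine tendsto_nhdsWithin_iff.2 ⟨?_, ?_⟩
      · have : Tendsto (fun x : ℝ => (x - r).toNNReal) (𝓝 r) (𝓝 (r - r).toNNReal) :=
          (continuous_real_toNNReal.comp (continuous_sub_right r)).tendsto r
        rw [sub_self, Real.toNNReal_zero] at this
        exact this.mono_left nhdsWithin_le_nhds
      · filter_upwards [self_mem_nhdsWithin] with x hx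
        exact Real.toNNReal_pos.2 (sub_pos.2 hx)
    refine ((hL.comp h1).mul_const (T r.toNNReal)).congr' ?_
    filter_upwards [self_mem_nhdsWithin] with x hx
    have hx' : 0 ≤ x - r := (sub_pos.2 hx).le
    have h2 : x.toNNReal = (x - r).toNNReal + r.toNNReal := by
      rw [← Real.toNNReal_add hx' hr, sub_add_cancel]
    rw [slope_def_module, h2, hadd, Function.comp_apply, Real.coe_toNNReal _ hx', smul_mul_assoc,
      sub_mul, one_mul, ← Complex.ofReal_inv, Complex.coe_smul]
  have huniq := ODE_solution_unique (v := fun _ y => L * y) (K := ‖L‖₊) (a := 0) (b := t)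
    (f := fun u : ℝ => T u.toNNReal) (g := fun u : ℝ => NormedSpace.exp (u • L))
    (fun _ => LipschitzWith.of_dist_le_mul fun x y => by
      rw [dist_eq_norm, dist_eq_norm, ← mul_sub]
      exact norm_mul_le _ _)
    (hTc.comp continuous_real_toNNReal).continuousOn
    (fun r hr => hderiv r hr.1)
    (fun r _ => (hexp r).continuousAt.continuousWithinAt)
    (fun r _ => (hexp r).hasDerivWithinAt)
    (by simp [h0])
  have heq : T (t : ℝ).toNNReal = NormedSpace.exp ((t : ℝ) • L) :=
    huniq ⟨t.coe_nonneg, le_refl (t : ℝ)⟩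
  rw [Real.toNNReal_coe] at heq
  rw [heq, Complex.coe_smul]

theorem exp_semigroup_add [NormedAlgebra ℂ 𝔸] (L : 𝔸) (s t : ℝ≥0) :
    NormedSpace.exp ((((s + t : ℝ≥0) : ℝ) : ℂ) • L) =
      NormedSpace.exp (((s : ℝ) : ℂ) • L) * NormedSpace.exp (((t : ℝ) : ℂ) • L) := by
  let := NormedAlgebra.restrictScalars ℚ ℂ 𝔸
  rw [NNReal.coe_add, Complex.ofReal_add, add_smul]
  exact NormedSpace.exp_add_of_commute (((Commute.refl L).smul_left _).smul_right _)

theorem continuous_exp_semigroup [NormedAlgebra ℂ 𝔸] (L : 𝔸) :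
    Continuous fun t : ℝ≥0 => NormedSpace.exp (((t : ℝ) : ℂ) • L) := by
  let := NormedAlgebra.restrictScalars ℚ ℂ 𝔸
  have h1 : Continuous fun t : ℝ≥0 => ((t : ℝ) : ℂ) :=
    Complex.continuous_ofReal.comp NNReal.continuous_coe
  exact NormedSpace.exp_continuous.comp (h1.smul continuous_const)

end Semigroup

namespace KMS

open scoped ComplexOrder

/-! ### Positivity in C⋆-algebras and on inner product spaces -/

/-- For self-adjoint `x`, take `n` to be its negative part and `r` the square root of `n`; then
`n x n = -n³`. -/
theorem exists_mul_mul_eq_neg_star_mul_self {A : Type*} [NonUnitalCStarAlgebra A] [PartialOrder A]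
    [StarOrderedRing A] {x : A} (hx : IsSelfAdjoint x) :
    ∃ n r : A, IsSelfAdjoint n ∧ n * x * n = -(star (r * n) * (r * n)) ∧
      (r * n = 0 → 0 ≤ x) := by
  have h1 := CFC.posPart_sub_negPart x
  have h2 := CFC.posPart_mul_negPart x
  have h3 := CFC.sqrt_mul_sqrt_self x⁻ (CFC.negPart_nonneg x)
  have h4 : IsSelfAdjoint x⁻ := (CFC.negPart_nonneg x).isSelfAdjoint
  have h5 : IsSelfAdjoint (CFC.sqrt x⁻) := (CFC.sqrt_nonneg x⁻).isSelfAdjoint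
  refine ⟨x⁻, CFC.sqrt x⁻, h4, ?_, fun h => ?_⟩
  · rw [star_mul, h4.star_eq, h5.star_eq]
    calc x⁻ * x * x⁻ = x⁻ * ((x⁺ - x⁻) * x⁻) := by rw [h1, mul_assoc]
      _ = -(x⁻ * (CFC.sqrt x⁻ * CFC.sqrt x⁻) * x⁻) := by rw [h3, sub_mul, h2]; noncomm_ring
      _ = _ := by simp only [mul_assoc]
  · have h6 : x⁻ = 0 := by
      rw [← CStarRing.star_mul_self_eq_zero_iff, h4.star_eq]
      nth_rw 1 [← h3]
      rw [mul_assoc, h, mul_zero]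
    rw [← h1, h6, sub_zero]
    exact CFC.posPart_nonneg x

theorem exists_eq_star_mul_self {A : Type*} [NonUnitalCStarAlgebra A] [PartialOrder A]
    [StarOrderedRing A] {x : A} (hx : 0 ≤ x) : ∃ z, x = star z * z :=
  CStarAlgebra.nonneg_iff_eq_star_mul_self.1 hx

variable {E : Type*} [NormedAddCommGroup E] [InnerProductSpace ℂ E]

theorem nonneg_of_forall_inner_nonneg {x : E →L[ℂ] E} (hx : ∀ u, 0 ≤ ⟪u, x u⟫_ℂ) : 0 ≤ x := by
  rw [ContinuousLinearMap.nonneg_iff_isPositive, ContinuousLinearMap.isPositive_iff_complex]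
  intro u
  have h1 := hx u
  rw [← inner_conj_symm, starRingEnd_apply, star_nonneg_iff] at h1
  obtain ⟨h2, h3⟩ := Complex.nonneg_iff.1 h1
  exact ⟨Complex.ext rfl h3, h2⟩

theorem inner_nonneg_of_nonneg {x : E →L[ℂ] E} (hx : 0 ≤ x) (u : E) : 0 ≤ ⟪u, x u⟫_ℂ :=
  ((ContinuousLinearMap.nonneg_iff_isPositive x).1 hx).inner_nonneg_right u

/-- The functional `x ↦ ∑ₙ ⟨uₙ, x vₙ⟩` is norm continuous. -/
theorem continuous_tsum_inner {u v : ℕ → E} (hu : Summable fun n => ‖u n‖ ^ 2)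
    (hv : Summable fun n => ‖v n‖ ^ 2) :
    Continuous fun x : E →L[ℂ] E => ∑' n, ⟪u n, x (v n)⟫_ℂ := by
  have hbd : ∀ (x : E →L[ℂ] E) n, ‖⟪u n, x (v n)⟫_ℂ‖ ≤ (‖u n‖ ^ 2 + ‖v n‖ ^ 2) * ‖x‖ := by
    intro x n
    have h1 : ‖⟪u n, x (v n)⟫_ℂ‖ ≤ ‖u n‖ * (‖x‖ * ‖v n‖) := (norm_inner_le_norm _ _).trans
      (mul_le_mul_of_nonneg_left (x.le_opNorm _) (norm_nonneg _))
    have h2 : ‖u n‖ * ‖v n‖ ≤ ‖u n‖ ^ 2 + ‖v n‖ ^ 2 := by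
      nlinarith [sq_nonneg (‖u n‖ - ‖v n‖), sq_nonneg ‖u n‖, sq_nonneg ‖v n‖]
    calc _ ≤ (‖u n‖ * ‖v n‖) * ‖x‖ := h1.trans_eq (by ring)
      _ ≤ _ := mul_le_mul_of_nonneg_right h2 (norm_nonneg _)
  have hsum : ∀ x : E →L[ℂ] E, Summable fun n => ⟪u n, x (v n)⟫_ℂ := fun x =>
    Summable.of_norm_bounded ((hu.add hv).mul_right _) (hbd x)
  let f : (E →L[ℂ] E) →ₗ[ℂ] ℂ :=
    { toFun := fun x => ∑' n, ⟪u n, x (v n)⟫_ℂ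
      map_add' := fun x y => by
        rw [← (hsum x).tsum_add (hsum y)]
        exact tsum_congr fun n => by rw [add_apply, inner_add_right]
      map_smul' := fun c x => by
        rw [smul_eq_mul, ← tsum_mul_left]
        exact tsum_congr fun n => by rw [smul_apply, inner_smul_right]; rfl }
  exact (f.mkContinuous _ fun x =>
    tsum_of_norm_bounded ((hu.add hv).hasSum.mul_right ‖x‖) (hbd x)).continuous

/-! ### Positivity of matrices over `B(h)` -/

variable {h : Type*} [NormedAddCommGroup h] [InnerProductSpace ℂ h] [CompleteSpace h]

/-- With the elements `n`, `r` of `exists_mul_mul_eq_neg_star_mul_self`, the diagonal entries of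
`n X n` are both positive, by hypothesis, and negative, being those of `-(r n)* (r n)`. -/
theorem cstarMatrix_nonneg_of_forall_sum_inner {k : ℕ} {X : CStarMatrix (Fin k) (Fin k) (BOp h)}
    (hX : IsSelfAdjoint X) (hw : ∀ w : Fin k → h, 0 ≤ ∑ i, ∑ j, ⟪w i, X i j (w j)⟫_ℂ) :
    0 ≤ X := by
  obtain ⟨n, r, hn, h1, h2⟩ := exists_mul_mul_eq_neg_star_mul_self hX
  refine h2 ?_
  set m := r * n
  ext p l u
  have hn' : ∀ i j, ContinuousLinearMap.adjoint (n i j) = n j i := fun i j => by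
    rw [← ContinuousLinearMap.star_eq_adjoint, ← CStarMatrix.star_apply, hn.star_eq]
  have h3 : ⟪u, (n * X * n) l l u⟫_ℂ = ∑ i, ∑ j, ⟪n i l u, X i j (n j l u)⟫_ℂ := by
    rw [Finset.sum_comm]
    simp only [CStarMatrix.mul_apply, sum_apply, inner_sum, Finset.sum_mul]
    refine Finset.sum_congr rfl fun j _ => Finset.sum_congr rfl fun i _ => ?_
    rw [mul_apply_eq_comp, mul_apply_eq_comp, ← ContinuousLinearMap.adjoint_inner_left, hn']
  have h4 : ⟪u, (star m * m) l l u⟫_ℂ = ((∑ i, ‖m i l u‖ ^ 2 : ℝ) : ℂ) := by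
    simp only [CStarMatrix.mul_apply, sum_apply, inner_sum]
    rw [Complex.ofReal_sum]
    refine Finset.sum_congr rfl fun i _ => ?_
    rw [Complex.ofReal_pow, mul_apply_eq_comp, CStarMatrix.star_apply,
      ContinuousLinearMap.star_eq_adjoint,
      ContinuousLinearMap.adjoint_inner_right, inner_self_eq_norm_sq_to_K]
    rfl
  have h5 := hw fun i => n i l u
  rw [← h3, h1, CStarMatrix.neg_apply, neg_apply, inner_neg_right, h4, ← Complex.ofReal_neg,
    Complex.zero_le_real] at h5
  have h6 : ∑ i, ‖m i l u‖ ^ 2 = 0 :=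
    le_antisymm (by linarith) (Finset.sum_nonneg fun i _ => sq_nonneg _)
  rw [Finset.sum_eq_zero_iff_of_nonneg fun i _ => sq_nonneg _] at h6
  simpa using h6 p (Finset.mem_univ p)

/-- A self-adjoint operator is a difference of positive ones, so its image is self-adjoint. -/
theorem map_star_of_forall_nonneg {f : BOp h →ₗ[ℂ] BOp h} (hf : ∀ x, 0 ≤ x → 0 ≤ f x) (x : BOp h) :
    f (star x) = star (f x) := by
  have hsa : ∀ y : BOp h, IsSelfAdjoint y → IsSelfAdjoint (f y) := fun y hy => by
    rw [← CFC.posPart_sub_negPart y, map_sub]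
    exact (hf _ (CFC.posPart_nonneg y)).isSelfAdjoint.sub
      (hf _ (CFC.negPart_nonneg y)).isSelfAdjoint
  rw [← realPart_add_I_smul_imaginaryPart x]
  simp only [star_add, star_smul, map_add, map_smul, (hsa _ (realPart x).2).star_eq,
    (hsa _ (imaginaryPart x).2).star_eq, (realPart x).2.star_eq, (imaginaryPart x).2.star_eq]

/-! ### Hilbert-Schmidt operators and cyclicity of the trace -/

/-- `A` is a Hilbert-Schmidt operator: `∑ᵢ ‖A eᵢ‖² < ∞` for the fixed orthonormal basis. -/
noncomputable def IsHilbertSchmidt (A : BOp h) : Prop := Summable fun i => ‖A (onb h i)‖ ^ 2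

theorem hasSum_norm_inner_onb_sq (v : h) :
    HasSum (fun j => ‖⟪onb h j, v⟫_ℂ‖ ^ 2) (‖v‖ ^ 2) := by
  rw [← Complex.hasSum_ofReal]
  convert! (onb h).hasSum_inner_mul_inner v v using 1
  · funext j
    rw [← inner_conj_symm v, Complex.conj_mul']
    push_cast
    rfl
  · rw [inner_self_eq_norm_sq_to_K]
    push_cast
    rfl

theorem IsHilbertSchmidt.mul_left {A : BOp h} (hA : IsHilbertSchmidt A) (B : BOp h) :
    IsHilbertSchmidt (B * A) := by
  have h1 : Summable fun i => ‖B‖ ^ 2 * ‖A (onb h i)‖ ^ 2 := Summable.mul_left _ hA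
  refine Summable.of_nonneg_of_le (fun _ => by positivity) (fun i => ?_) h1
  rw [← mul_pow, mul_apply_eq_comp]
  gcongr
  exact B.le_opNorm _

theorem IsHilbertSchmidt.summable_entries {A : BOp h} (hA : IsHilbertSchmidt A) :
    Summable fun p : onbIndex h × onbIndex h => ‖⟪onb h p.2, A (onb h p.1)⟫_ℂ‖ ^ 2 := by
  rw [summable_prod_of_nonneg (fun p => by positivity)]
  refine ⟨fun i => (hasSum_norm_inner_onb_sq (A (onb h i))).summable, ?_⟩
  simp only [(hasSum_norm_inner_onb_sq _).tsum_eq]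
  exact hA

theorem IsHilbertSchmidt.star {A : BOp h} (hA : IsHilbertSchmidt A) :
    IsHilbertSchmidt (star A) := by
  have h1 := hA.summable_entries.prod_symm
  rw [summable_prod_of_nonneg (fun p => by positivity)] at h1
  refine h1.2.congr fun j => ?_
  rw [← (hasSum_norm_inner_onb_sq _).tsum_eq]
  refine tsum_congr fun i => ?_
  simp only [Prod.fst_swap, Prod.snd_swap]
  rw [ContinuousLinearMap.star_eq_adjoint, ContinuousLinearMap.adjoint_inner_right,
    norm_inner_symm]

theorem IsHilbertSchmidt.mul_right {A : BOp h} (hA : IsHilbertSchmidt A) (B : BOp h) :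
    IsHilbertSchmidt (A * B) := by
  have := (hA.star.mul_left (Star.star B)).star
  rwa [star_mul, star_star, star_star] at this

theorem IsHilbertSchmidt.summable_entries_mul {A B : BOp h} (hA : IsHilbertSchmidt A)
    (hB : IsHilbertSchmidt B) :
    Summable fun p : onbIndex h × onbIndex h =>
      ⟪onb h p.1, A (onb h p.2)⟫_ℂ * ⟪onb h p.2, B (onb h p.1)⟫_ℂ := by
  refine Summable.of_norm_bounded (hA.summable_entries.prod_symm.add hB.summable_entries)
    fun p => ?_
  rw [norm_mul]
  simp only [Prod.fst_swap, Prod.snd_swap]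
  nlinarith [sq_nonneg (‖⟪onb h p.1, A (onb h p.2)⟫_ℂ‖ - ‖⟪onb h p.2, B (onb h p.1)⟫_ℂ‖),
    sq_nonneg ‖⟪onb h p.1, A (onb h p.2)⟫_ℂ‖, sq_nonneg ‖⟪onb h p.2, B (onb h p.1)⟫_ℂ‖]

theorem IsHilbertSchmidt.hasSum_diag_mul {A B : BOp h} (hA : IsHilbertSchmidt A)
    (hB : IsHilbertSchmidt B) :
    HasSum (fun i => ⟪onb h i, (A * B) (onb h i)⟫_ℂ)
      (∑' p : onbIndex h × onbIndex h,
        ⟪onb h p.1, A (onb h p.2)⟫_ℂ * ⟪onb h p.2, B (onb h p.1)⟫_ℂ) := by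
  refine (hA.summable_entries_mul hB).hasSum.prod_fiberwise fun i => ?_
  have := (onb h).hasSum_inner_mul_inner (Star.star A (onb h i)) (B (onb h i))
  simpa only [ContinuousLinearMap.star_eq_adjoint, ContinuousLinearMap.adjoint_inner_left,
    mul_apply_eq_comp] using this

theorem IsHilbertSchmidt.summable_diag_mul {A B : BOp h} (hA : IsHilbertSchmidt A)
    (hB : IsHilbertSchmidt B) :
    Summable (fun i => ⟪onb h i, (A * B) (onb h i)⟫_ℂ) :=
  (hA.hasSum_diag_mul hB).summable

/-- Both traces are the sum of the same double series `∑ᵢⱼ ⟨eᵢ, A eⱼ⟩⟨eⱼ, B eᵢ⟩`. -/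
theorem IsHilbertSchmidt.opTrace_mul_comm {A B : BOp h} (hA : IsHilbertSchmidt A)
    (hB : IsHilbertSchmidt B) : opTrace (A * B) = opTrace (B * A) := by
  rw [opTrace, opTrace, (hA.hasSum_diag_mul hB).tsum_eq, (hB.hasSum_diag_mul hA).tsum_eq,
    ← (Equiv.prodComm _ _).tsum_eq]
  exact tsum_congr fun p => mul_comm _ _

theorem opTrace_mul_star_self_nonneg (A : BOp h) : 0 ≤ opTrace (A * star A) := by
  refine tsum_nonneg fun i => ?_
  rw [mul_apply_eq_comp, ← ContinuousLinearMap.adjoint_inner_left,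
    ← ContinuousLinearMap.star_eq_adjoint]
  rw [inner_self_eq_norm_sq_to_K, ← RCLike.ofReal_pow]
  exact RCLike.ofReal_nonneg.2 (sq_nonneg _)

theorem opTrace_rankOne (u v : h) : opTrace (InnerProductSpace.rankOne ℂ u v) = ⟪v, u⟫_ℂ := by
  rw [opTrace, ← (onb h).tsum_inner_mul_inner]
  refine tsum_congr fun i => ?_
  rw [InnerProductSpace.rankOne_apply, inner_smul_right]

/-! ### The KMS form -/

/-- The KMS form `(x, y) ↦ tr (s x s y)` of a Hilbert-Schmidt operator `s`, to be taken as
`ρ^{1/2}`. The trace is linear here because its series converges, `s x` and `s y` being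
Hilbert-Schmidt. -/
noncomputable def kmsForm (s : BOp h) (hs : IsHilbertSchmidt s) : BOp h →ₗ[ℂ] BOp h →ₗ[ℂ] ℂ :=
  have hsum : ∀ x y : BOp h, Summable fun i => ⟪onb h i, (s * x * s * y) (onb h i)⟫_ℂ :=
    fun x y => by
      rw [mul_assoc]
      exact (hs.mul_right x).summable_diag_mul (hs.mul_right y)
  LinearMap.mk₂ ℂ (fun x y => opTrace (s * x * s * y))
    (fun x x' y => by
      rw [opTrace, opTrace, opTrace, ← (hsum x y).tsum_add (hsum x' y)]
      refine tsum_congr fun i => ?_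
      rw [mul_add, add_mul, add_mul, add_apply, inner_add_right])
    (fun c x y => by
      rw [opTrace, opTrace, smul_eq_mul, ← tsum_mul_left]
      refine tsum_congr fun i => ?_
      rw [mul_smul_comm, smul_mul_assoc, smul_mul_assoc, smul_apply,
        inner_smul_right])
    (fun x y y' => by
      rw [opTrace, opTrace, opTrace, ← (hsum x y).tsum_add (hsum x y')]
      refine tsum_congr fun i => ?_
      rw [mul_add, add_apply, inner_add_right])
    (fun c x y => by
      rw [opTrace, opTrace, smul_eq_mul, ← tsum_mul_left]
      refine tsum_congr fun i => ?_
      rw [mul_smul_comm, smul_apply, inner_smul_right])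

theorem kmsForm_apply (s : BOp h) (hs : IsHilbertSchmidt s) (x y : BOp h) :
    kmsForm s hs x y = opTrace (s * x * s * y) := rfl

theorem kmsForm_comm (s : BOp h) (hs : IsHilbertSchmidt s) (x y : BOp h) :
    kmsForm s hs x y = kmsForm s hs y x := by
  rw [kmsForm_apply, kmsForm_apply, mul_assoc,
    (hs.mul_right x).opTrace_mul_comm (hs.mul_right y), ← mul_assoc]

/-- From `⟨eᵢ, s x s y eᵢ⟩ = ⟨s* eᵢ, x s y eᵢ⟩`, a possible constant is
`∑ᵢ (‖s* eᵢ‖² + ‖s y eᵢ‖²)`. -/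
theorem exists_norm_kmsForm_le (s : BOp h) (hs : IsHilbertSchmidt s) (y : BOp h) :
    ∃ C, ∀ x, ‖kmsForm s hs x y‖ ≤ C * ‖x‖ := by
  have hsum : Summable fun i => ‖(star s) (onb h i)‖ ^ 2 + ‖(s * y) (onb h i)‖ ^ 2 :=
    Summable.add hs.star (hs.mul_right y)
  refine ⟨_, fun x => tsum_of_norm_bounded (hsum.hasSum.mul_right ‖x‖) fun i => ?_⟩
  rw [mul_assoc, mul_assoc, mul_apply_eq_comp, ← ContinuousLinearMap.adjoint_inner_left,
    mul_apply_eq_comp, ← ContinuousLinearMap.star_eq_adjoint]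
  set a := (star s) (onb h i)
  set b := (s * y) (onb h i)
  have h1 : ‖⟪a, x b⟫_ℂ‖ ≤ ‖a‖ * (‖x‖ * ‖b‖) :=
    (norm_inner_le_norm _ _).trans (mul_le_mul_of_nonneg_left (x.le_opNorm b) (norm_nonneg _))
  have h2 : ‖a‖ * ‖b‖ ≤ ‖a‖ ^ 2 + ‖b‖ ^ 2 := by
    nlinarith [sq_nonneg (‖a‖ - ‖b‖), sq_nonneg ‖a‖, sq_nonneg ‖b‖]
  calc _ ≤ (‖a‖ * ‖b‖) * ‖x‖ := h1.trans_eq (by ring)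
    _ ≤ _ := mul_le_mul_of_nonneg_right h2 (norm_nonneg _)

theorem continuous_kmsForm_left (s : BOp h) (hs : IsHilbertSchmidt s) (y : BOp h) :
    Continuous fun x => kmsForm s hs x y := by
  obtain ⟨C, hC⟩ := exists_norm_kmsForm_le s hs y
  exact (((kmsForm s hs).flip y).mkContinuous C hC).continuous

theorem continuous_kmsForm_right (s : BOp h) (hs : IsHilbertSchmidt s) (x : BOp h) :
    Continuous fun y => kmsForm s hs x y := by
  simp only [kmsForm_comm s hs x]
  exact continuous_kmsForm_left s hs x

theorem kmsForm_rankOne {s : BOp h} (hs : IsHilbertSchmidt s) (hsa : IsSelfAdjoint s) (x : BOp h)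
    (u v : h) :
    kmsForm s hs x (InnerProductSpace.rankOne ℂ v u) = ⟪s u, x (s v)⟫_ℂ := by
  have h1 : s * x * s * InnerProductSpace.rankOne ℂ v u =
      InnerProductSpace.rankOne ℂ (s (x (s v))) u := by
    ext w
    simp
  rw [kmsForm_apply, h1, opTrace_rankOne, ← ContinuousLinearMap.adjoint_inner_left,
    ← ContinuousLinearMap.star_eq_adjoint, hsa.star_eq]

/-- The KMS form separates points, already when `y` runs over the operators of rank one. -/
theorem eq_of_kmsForm_eq {s : BOp h} (hs : IsHilbertSchmidt s) (hsa : IsSelfAdjoint s)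
    (hd : DenseRange s) {x x' : BOp h} (hx : ∀ y, kmsForm s hs x y = kmsForm s hs x' y) :
    x = x' := by
  refine ContinuousLinearMap.coeFn_injective
    (hd.equalizer x.continuous x'.continuous (funext fun v => ?_))
  refine hd.eq_of_inner_right (𝕜 := ℂ) fun u => ?_
  have := hx (InnerProductSpace.rankOne ℂ v u)
  rwa [kmsForm_rankOne hs hsa, kmsForm_rankOne hs hsa] at this

theorem kmsForm_star_mul {s : BOp h} (hs : IsHilbertSchmidt s) (a b c d : BOp h) :
    kmsForm s hs (star a * b) (star c * d) = opTrace ((b * s * star c) * (d * s * star a)) := by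
  have h1 : s * (star a * b) * s * (star c * d) = (s * star a) * (b * s * star c * d) := by
    simp only [mul_assoc]
  rw [kmsForm_apply, h1, (hs.mul_right _).opTrace_mul_comm
    (((hs.mul_left b).mul_right (star c)).mul_right d)]
  simp only [mul_assoc]

/-- For positive matrices `X = Z* Z` and `Y = V* V`, the sum of the values of the form is
`∑ₖₗ tr (Mₖₗ Mₖₗ*)` with `Mₖₗ = ∑ⱼ Zₖⱼ s Vₗⱼ*`. -/
theorem sum_kmsForm_nonneg {s : BOp h} (hs : IsHilbertSchmidt s) (hsa : IsSelfAdjoint s)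
    {n : Type*} [Fintype n] (Z V : n → n → BOp h) :
    0 ≤ ∑ i, ∑ j, kmsForm s hs (∑ k, star (Z k i) * Z k j) (∑ l, star (V l j) * V l i) := by
  have hHS : ∀ k l j, IsHilbertSchmidt (Z k j * s * star (V l j)) := fun k l j =>
    (hs.mul_left _).mul_right _
  have hkl : ∀ k l, ∑ i, ∑ j, kmsForm s hs (star (Z k i) * Z k j) (star (V l j) * V l i) =
      opTrace ((∑ j, Z k j * s * star (V l j)) * star (∑ i, Z k i * s * star (V l i))) := by
    intro k l
    have h1 : ∀ i, star (Z k i * s * star (V l i)) = V l i * s * star (Z k i) := fun i => by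
      rw [star_mul, star_mul, star_star, hsa.star_eq, mul_assoc]
    have h2 : ∀ i j, Summable fun m => ⟪onb h m, ((Z k j * s * star (V l j)) *
        star (Z k i * s * star (V l i))) (onb h m)⟫_ℂ := fun i j =>
      (hHS k l j).summable_diag_mul (hHS k l i).star
    simp only [kmsForm_star_mul hs, opTrace]
    simp only [← h1]
    have h3 : ∀ i, ∑ j, ∑' m, ⟪onb h m, ((Z k j * s * star (V l j)) *
        star (Z k i * s * star (V l i))) (onb h m)⟫_ℂ = ∑' m, ∑ j, ⟪onb h m,
          ((Z k j * s * star (V l j)) * star (Z k i * s * star (V l i))) (onb h m)⟫_ℂ := fun i =>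
      (Summable.tsum_finsetSum fun j _ => h2 i j).symm
    simp only [h3]
    rw [← Summable.tsum_finsetSum fun i _ => summable_sum fun j _ => h2 i j]
    refine tsum_congr fun m => ?_
    rw [star_sum, Finset.sum_mul_sum, Finset.sum_comm]
    simp only [sum_apply, inner_sum]
  have hrw : ∑ i, ∑ j, kmsForm s hs (∑ k, star (Z k i) * Z k j) (∑ l, star (V l j) * V l i) =
      ∑ k, ∑ l, ∑ i, ∑ j, kmsForm s hs (star (Z k i) * Z k j) (star (V l j) * V l i) := by
    have hcomm : ∀ f : n → n → n → n → ℂ,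
        ∑ i, ∑ j, ∑ k, ∑ l, f i j k l = ∑ k, ∑ l, ∑ i, ∑ j, f i j k l := fun f => calc
      _ = ∑ i, ∑ k, ∑ j, ∑ l, f i j k l := Finset.sum_congr rfl fun _ _ => Finset.sum_comm
      _ = ∑ k, ∑ i, ∑ j, ∑ l, f i j k l := Finset.sum_comm
      _ = ∑ k, ∑ i, ∑ l, ∑ j, f i j k l :=
        Finset.sum_congr rfl fun _ _ => Finset.sum_congr rfl fun _ _ => Finset.sum_comm
      _ = _ := Finset.sum_congr rfl fun _ _ => Finset.sum_comm
    rw [← hcomm]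
    refine Finset.sum_congr rfl fun i _ => Finset.sum_congr rfl fun j _ => ?_
    rw [map_sum (kmsForm s hs), LinearMap.sum_apply]
    exact Finset.sum_congr rfl fun k _ => map_sum _ _ _
  rw [hrw]
  refine Finset.sum_nonneg fun k _ => Finset.sum_nonneg fun l _ => ?_
  rw [hkl]
  exact opTrace_mul_star_self_nonneg _

/-! ### Testing positivity with the KMS form -/

theorem kmsForm_nonneg {s : BOp h} (hs : IsHilbertSchmidt s) (hsa : IsSelfAdjoint s) {x y : BOp h}
    (hx : 0 ≤ x) (hy : 0 ≤ y) : 0 ≤ kmsForm s hs x y := by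
  obtain ⟨z, rfl⟩ := exists_eq_star_mul_self hx
  obtain ⟨v, rfl⟩ := exists_eq_star_mul_self hy
  simpa using sum_kmsForm_nonneg hs hsa (n := Unit) (fun _ _ => z) (fun _ _ => v)

/-- It is enough to test with the projections `|w⟩⟨w|`, which give `⟨s w, x s w⟩`. -/
theorem nonneg_of_forall_kmsForm_nonneg {s : BOp h} (hs : IsHilbertSchmidt s)
    (hsa : IsSelfAdjoint s) (hd : DenseRange s) {x : BOp h}
    (hx : ∀ y, 0 ≤ y → 0 ≤ kmsForm s hs x y) : 0 ≤ x := by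
  refine nonneg_of_forall_inner_nonneg fun u => ?_
  refine hd.induction_on u (isClosed_le continuous_const (by fun_prop)) fun w => ?_
  rw [← kmsForm_rankOne hs hsa]
  exact hx _ ((ContinuousLinearMap.nonneg_iff_isPositive _).2
    (InnerProductSpace.isPositive_rankOne_self w))

/-- The matrix `(|vⱼ⟩⟨vᵢ|)ⱼᵢ` is the positive matrix which makes the KMS form of a matrix `X` equal
to `∑ᵢⱼ ⟨s vᵢ, Xᵢⱼ s vⱼ⟩`. -/
theorem cstarMatrix_nonneg_of_forall_kmsForm_nonneg {s : BOp h} (hs : IsHilbertSchmidt s)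
    (hsa : IsSelfAdjoint s) (hd : DenseRange s) {k : ℕ} {X : CStarMatrix (Fin k) (Fin k) (BOp h)}
    (hX : IsSelfAdjoint X)
    (hXY : ∀ Y : CStarMatrix (Fin k) (Fin k) (BOp h), 0 ≤ Y →
      0 ≤ ∑ i, ∑ j, kmsForm s hs (X i j) (Y j i)) : 0 ≤ X := by
  refine cstarMatrix_nonneg_of_forall_sum_inner hX fun w => ?_
  have hdense : DenseRange (Pi.map fun (_ : Fin k) (v : h) => s v) := DenseRange.piMap fun _ => hd
  refine hdense.induction_on w (isClosed_le continuous_const (by fun_prop)) fun v => ?_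
  simp only [Pi.map_apply, ← kmsForm_rankOne hs hsa]
  set Y : CStarMatrix (Fin k) (Fin k) (BOp h) :=
    CStarMatrix.ofMatrix fun j i => InnerProductSpace.rankOne ℂ (v j) (v i)
  have hY : ∀ j i, Y j i = InnerProductSpace.rankOne ℂ (v j) (v i) := fun _ _ => rfl
  simp only [← hY]
  refine hXY Y (cstarMatrix_nonneg_of_forall_sum_inner ?_ fun u => ?_)
  · ext i j u
    rw [CStarMatrix.star_apply, hY, hY, ContinuousLinearMap.star_eq_adjoint,
      InnerProductSpace.adjoint_rankOne]
  · have h1 : ∀ i j, ⟪u i, Y i j (u j)⟫_ℂ = ⟪u i, v i⟫_ℂ * ⟪v j, u j⟫_ℂ := fun i j => by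
      rw [hY, InnerProductSpace.rankOne_apply, inner_smul_right, mul_comm]
    simp only [h1]
    rw [← Finset.sum_mul_sum]
    have h2 : ∑ j, ⟪v j, u j⟫_ℂ = star (∑ i, ⟪u i, v i⟫_ℂ) := by
      rw [star_sum]
      exact Finset.sum_congr rfl fun j _ => (inner_conj_symm _ _).symm
    rw [h2]
    exact mul_star_self_nonneg _

/-! ### Increasing nets of operators -/

theorem norm_apply_sq_le_of_nonneg {p : BOp h} (hp : 0 ≤ p) (v : h) :
    ‖p v‖ ^ 2 ≤ ‖p‖ * RCLike.re ⟪v, p v⟫_ℂ := by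
  obtain ⟨r, rfl⟩ := exists_eq_star_mul_self hp
  have h1 : RCLike.re ⟪v, (star r * r) v⟫_ℂ = ‖r v‖ ^ 2 := by
    rw [mul_apply_eq_comp, ContinuousLinearMap.star_eq_adjoint,
      ContinuousLinearMap.adjoint_inner_right, inner_self_eq_norm_sq]
  rw [h1, CStarRing.norm_star_mul_self, mul_apply_eq_comp, ← pow_two, ← mul_pow]
  refine pow_le_pow_left₀ (norm_nonneg _) ?_ 2
  exact ((star r).le_opNorm _).trans_eq (by rw [norm_star])

/-- Vigier's theorem: a bounded increasing net of operators converges strongly to its supremum. The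
net is Cauchy at each vector `v`, since `‖(x' - x) v‖² ≤ ‖x' - x‖ ⟨v, (x' - x) v⟩`. -/
theorem tendsto_apply_of_isLUB {d : Set (BOp h)} (hdir : DirectedOn (· ≤ ·) d) {a x₀ : BOp h}
    (ha : IsLUB d a) (hx₀ : x₀ ∈ d) (hle : ∀ x ∈ d, x₀ ≤ x) (v : h) :
    Tendsto (fun x : d => (x : BOp h) v) atTop (𝓝 (a v)) := by
  have : Nonempty d := ⟨⟨x₀, hx₀⟩⟩
  have : IsDirectedOrder d := ⟨directedOn_iff_directed.1 hdir⟩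
  have hmono : ∀ {x y : BOp h}, x ≤ y → ∀ u, RCLike.re ⟪u, x u⟫_ℂ ≤ RCLike.re ⟪u, y u⟫_ℂ := by
    intro x y hxy u
    have := (Complex.nonneg_iff.1 (inner_nonneg_of_nonneg (sub_nonneg.2 hxy) u)).1
    rw [sub_apply, inner_sub_right, Complex.sub_re] at this
    exact sub_nonneg.1 this
  have hsub : ∀ x ∈ d, ∀ y ∈ d, x ≤ y → ∀ u, ‖y u - x u‖ ^ 2 ≤
      ‖a - x₀‖ * (RCLike.re ⟪u, y u⟫_ℂ - RCLike.re ⟪u, x u⟫_ℂ) := by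
    intro x hx y hy hxy u
    have h1 := norm_apply_sq_le_of_nonneg (sub_nonneg.2 hxy) u
    have h2 : ‖y - x‖ ≤ ‖a - x₀‖ := CStarAlgebra.norm_le_norm_of_nonneg_of_le
      (sub_nonneg.2 hxy) (sub_le_sub (ha.1 hy) (hle x hx))
    rw [sub_apply, inner_sub_right, map_sub] at h1
    exact h1.trans (mul_le_mul_of_nonneg_right h2 (sub_nonneg.2 (hmono hxy u)))
  have hconv : ∀ u, ∃ w, Tendsto (fun x : d => (x : BOp h) u) atTop (𝓝 w) := by
    intro u
    refine cauchy_map_iff_exists_tendsto.1 (Metric.cauchy_iff.2 ⟨inferInstance, fun ε hε => ?_⟩)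
    have hbdd : BddAbove (Set.range fun x : d => RCLike.re ⟪u, (x : BOp h) u⟫_ℂ) :=
      ⟨RCLike.re ⟪u, a u⟫_ℂ, by rintro _ ⟨x, rfl⟩; exact hmono (ha.1 x.2) u⟩
    set C := ‖a - x₀‖ + 1
    have hC : 0 < C := by positivity
    obtain ⟨n, hn⟩ := exists_lt_of_lt_ciSup (sub_lt_self
      (⨆ x : d, RCLike.re ⟪u, (x : BOp h) u⟫_ℂ) (show 0 < (ε / 2) ^ 2 / C by positivity))
    have hclose : ∀ x : d, n ≤ x → ‖(x : BOp h) u - (n : BOp h) u‖ < ε / 2 := by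
      intro x hx
      have h1 := hsub n n.2 x x.2 hx u
      have h2 : RCLike.re ⟪u, (x : BOp h) u⟫_ℂ - RCLike.re ⟪u, (n : BOp h) u⟫_ℂ <
          (ε / 2) ^ 2 / C := by linarith [le_ciSup hbdd x]
      have h3 := sub_nonneg.2 (hmono (show (n : BOp h) ≤ x from hx) u)
      rw [lt_div_iff₀ hC] at h2
      refine lt_of_pow_lt_pow_left₀ 2 (by positivity) (h1.trans_lt (lt_of_le_of_lt ?_ h2))
      rw [mul_comm]
      exact mul_le_mul_of_nonneg_left (by simp [C]) h3
    refine ⟨(fun x : d => (x : BOp h) u) '' Set.Ici n, image_mem_map (Ici_mem_atTop n), ?_⟩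
    rintro _ ⟨x, hx, rfl⟩ _ ⟨y, hy, rfl⟩
    have h1 := dist_triangle_right ((x : BOp h) u) ((y : BOp h) u) ((n : BOp h) u)
    rw [dist_eq_norm ((x : BOp h) u) ((n : BOp h) u),
      dist_eq_norm ((y : BOp h) u) ((n : BOp h) u)] at h1
    linarith [hclose x hx, hclose y hy]
  choose f hf using hconv
  have hbd : Bornology.IsBounded (Set.range fun x : d => (x : BOp h)) := by
    refine (Metric.isBounded_closedBall (x := x₀) (r := ‖a - x₀‖)).subset ?_
    rintro _ ⟨x, rfl⟩
    rw [Metric.mem_closedBall, dist_eq_norm]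
    exact CStarAlgebra.norm_le_norm_of_nonneg_of_le (sub_nonneg.2 (hle x x.2))
      (sub_le_sub_right (ha.1 x.2) _)
  -- The strong limit is itself a supremum of `d`, hence equal to `a`.
  let b : BOp h := ContinuousLinearMap.ofTendstoOfBoundedRange f (fun x : d => (x : BOp h))
    (tendsto_pi_nhds.2 hf) hbd
  have hb : ∀ u, Tendsto (fun x : d => (x : BOp h) u) atTop (𝓝 (b u)) := hf
  have hlub : IsLUB d b := by
    refine ⟨fun x hx => ?_, fun c hc => ?_⟩
    · rw [← sub_nonneg]
      refine nonneg_of_forall_inner_nonneg fun u => ?_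
      refine ge_of_tendsto (tendsto_const_nhds.inner ((hb u).sub_const (x u))) ?_
      filter_upwards [Ici_mem_atTop (⟨x, hx⟩ : d)] with y hy
      exact inner_nonneg_of_nonneg (sub_nonneg.2 (show x ≤ y from hy)) u
    · rw [← sub_nonneg]
      refine nonneg_of_forall_inner_nonneg fun u => ?_
      refine ge_of_tendsto' (tendsto_const_nhds.inner ((hb u).const_sub (c u))) fun y => ?_
      exact inner_nonneg_of_nonneg (sub_nonneg.2 (hc y.2)) u
  rw [ha.unique hlub]
  exact hb v

/-- Normality of the functional `B(·, y)`, by dominated convergence of the trace series. -/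
theorem tendsto_kmsForm_of_isLUB {s : BOp h} (hs : IsHilbertSchmidt s) {d : Set (BOp h)}
    (hdir : DirectedOn (· ≤ ·) d) {a x₀ : BOp h} (ha : IsLUB d a) (hx₀ : x₀ ∈ d)
    (hle : ∀ x ∈ d, x₀ ≤ x) (y : BOp h) :
    Tendsto (fun x : d => kmsForm s hs x y) atTop (𝓝 (kmsForm s hs a y)) := by
  have hsum : Summable fun i => ‖(star s) (onb h i)‖ ^ 2 + ‖(s * y) (onb h i)‖ ^ 2 :=
    Summable.add hs.star (hs.mul_right y)
  simp only [kmsForm_apply, mul_assoc]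
  have key : ∀ (x : BOp h) i, ⟪onb h i, (s * (x * (s * y))) (onb h i)⟫_ℂ =
      ⟪(star s) (onb h i), x ((s * y) (onb h i))⟫_ℂ := fun x i => by
    rw [mul_apply_eq_comp, ← ContinuousLinearMap.adjoint_inner_left,
      mul_apply_eq_comp, ← ContinuousLinearMap.star_eq_adjoint]
  simp only [opTrace, key]
  refine tendsto_tsum_of_dominated_convergence (hsum.mul_left (‖x₀‖ + ‖a - x₀‖)) (fun i => ?_)
    (Eventually.of_forall fun x i => ?_)
  · exact tendsto_const_nhds.inner (tendsto_apply_of_isLUB hdir ha hx₀ hle _)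
  · have hx : ‖(x : BOp h)‖ ≤ ‖x₀‖ + ‖a - x₀‖ := by
      have h1 : ‖(x : BOp h) - x₀‖ ≤ ‖a - x₀‖ := CStarAlgebra.norm_le_norm_of_nonneg_of_le
        (sub_nonneg.2 (hle x x.2)) (sub_le_sub_right (ha.1 x.2) _)
      have h2 := norm_add_le x₀ ((x : BOp h) - x₀)
      rw [add_sub_cancel] at h2
      linarith
    set u := (star s) (onb h i)
    set w := (s * y) (onb h i)
    have h1 : ‖⟪u, (x : BOp h) w⟫_ℂ‖ ≤ ‖u‖ * (‖(x : BOp h)‖ * ‖w‖) := (norm_inner_le_norm _ _).trans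
      (mul_le_mul_of_nonneg_left ((x : BOp h).le_opNorm w) (norm_nonneg _))
    have h2 : ‖u‖ * ‖w‖ ≤ ‖u‖ ^ 2 + ‖w‖ ^ 2 := by
      nlinarith [sq_nonneg (‖u‖ - ‖w‖), sq_nonneg ‖u‖, sq_nonneg ‖w‖]
    calc _ ≤ ‖(x : BOp h)‖ * (‖u‖ * ‖w‖) := h1.trans_eq (by ring)
      _ ≤ _ := mul_le_mul hx h2 (by positivity) (by positivity)

/-! ### Maps adjoint for the KMS form -/

theorem nonneg_map_of_kmsAdjoint {s : BOp h} (hs : IsHilbertSchmidt s) (hsa : IsSelfAdjoint s)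
    (hd : DenseRange s) {f g : BOp h →ₗ[ℂ] BOp h}
    (hfg : ∀ x y, kmsForm s hs (f x) y = kmsForm s hs x (g y))
    (hg : ∀ y, 0 ≤ y → 0 ≤ g y) {x : BOp h} (hx : 0 ≤ x) : 0 ≤ f x :=
  nonneg_of_forall_kmsForm_nonneg hs hsa hd fun y hy => by
    rw [hfg]
    exact kmsForm_nonneg hs hsa hx (hg y hy)

/-- If `b` is an upper bound of all `f x`, then `B(b - f a, y)` is for positive `y` the limit of
`B(b, y) - B(x, g y) = B(b - f x, y) ≥ 0`. -/
theorem scottContinuous_of_kmsAdjoint {s : BOp h} (hs : IsHilbertSchmidt s) (hsa : IsSelfAdjoint s)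
    (hd : DenseRange s) {f g : BOp h →ₗ[ℂ] BOp h}
    (hfg : ∀ x y, kmsForm s hs (f x) y = kmsForm s hs x (g y))
    (hg : ∀ y, 0 ≤ y → 0 ≤ g y) : ScottContinuous f := by
  have hmono : Monotone f := fun x y hxy => by
    rw [← sub_nonneg, ← map_sub]
    exact nonneg_map_of_kmsAdjoint hs hsa hd hfg hg (sub_nonneg.2 hxy)
  intro d hne hdir a ha
  refine ⟨hmono.mem_upperBounds_image ha.1, fun b hb => ?_⟩
  obtain ⟨x₀, hx₀⟩ := hne
  -- The tail of `d` above `x₀` is bounded below and has the same supremum.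
  set d' : Set (BOp h) := {x ∈ d | x₀ ≤ x}
  have hdir' : DirectedOn (· ≤ ·) d' := fun x hx y hy => by
    obtain ⟨z, hz, hxz, hyz⟩ := hdir x hx.1 y hy.1
    exact ⟨z, ⟨hz, hx.2.trans hxz⟩, hxz, hyz⟩
  have ha' : IsLUB d' a := by
    refine ⟨fun x hx => ha.1 hx.1, fun c hc => ha.2 fun x hx => ?_⟩
    obtain ⟨z, hz, hxz, hyz⟩ := hdir x hx x₀ hx₀
    exact hxz.trans (hc ⟨hz, hyz⟩)
  have hx₀' : x₀ ∈ d' := ⟨hx₀, le_rfl⟩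
  have : Nonempty d' := ⟨⟨x₀, hx₀'⟩⟩
  have : IsDirectedOrder d' := ⟨directedOn_iff_directed.1 hdir'⟩
  rw [← sub_nonneg]
  refine nonneg_of_forall_kmsForm_nonneg hs hsa hd fun y hy => ?_
  rw [map_sub, LinearMap.sub_apply, hfg]
  refine ge_of_tendsto' ((tendsto_kmsForm_of_isLUB hs hdir' ha' hx₀' (fun x hx => hx.2)
    (g y)).const_sub (kmsForm s hs b y)) fun x => ?_
  rw [← hfg, ← LinearMap.sub_apply, ← map_sub]
  exact kmsForm_nonneg hs hsa (sub_nonneg.2 (hb (Set.mem_image_of_mem f x.2.1))) hy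

/-- The adjoint of a completely positive map is completely positive, as
`∑ᵢⱼ B(f Xᵢⱼ, Yⱼᵢ) = ∑ᵢⱼ B(Xᵢⱼ, g Yⱼᵢ)` is positive for positive matrices `X` and `Y`. -/
theorem nonneg_map_cstarMatrix_of_kmsAdjoint {s : BOp h} (hs : IsHilbertSchmidt s)
    (hsa : IsSelfAdjoint s) (hd : DenseRange s) {f g : BOp h →ₗ[ℂ] BOp h}
    (hfg : ∀ x y, kmsForm s hs (f x) y = kmsForm s hs x (g y))
    (hg : ∀ (k : ℕ) (Y : CStarMatrix (Fin k) (Fin k) (BOp h)), 0 ≤ Y → 0 ≤ Y.map g)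
    (hg' : ∀ y, 0 ≤ y → 0 ≤ g y) {k : ℕ} {X : CStarMatrix (Fin k) (Fin k) (BOp h)} (hX : 0 ≤ X) :
    0 ≤ X.map f := by
  refine cstarMatrix_nonneg_of_forall_kmsForm_nonneg hs hsa hd ?_ fun Y hY => ?_
  · ext i j : 1
    rw [CStarMatrix.star_apply, CStarMatrix.map_apply, CStarMatrix.map_apply,
      ← map_star_of_forall_nonneg fun x hx => nonneg_map_of_kmsAdjoint hs hsa hd hfg hg' hx,
      ← CStarMatrix.star_apply, (show IsSelfAdjoint X from hX.isSelfAdjoint).star_eq]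
  · obtain ⟨Z, hZ⟩ := exists_eq_star_mul_self hX
    obtain ⟨V, hV⟩ := exists_eq_star_mul_self (hg k Y hY)
    have h1 : ∀ i j, kmsForm s hs (X.map f i j) (Y j i) =
        kmsForm s hs (∑ m, star (Z m i) * Z m j) (∑ l, star (V l j) * V l i) := fun i j => by
      have h2 : g (Y j i) = Y.map g j i := rfl
      rw [CStarMatrix.map_apply, hfg, h2, hV, hZ,
        CStarMatrix.mul_apply, CStarMatrix.mul_apply]
      simp only [CStarMatrix.star_apply]
    simp only [h1]
    exact sum_kmsForm_nonneg hs hsa (fun i j => Z i j) (fun i j => V i j)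

/-! ### The square root of a faithful state -/

theorem IsState.isHilbertSchmidt_sqrt {ρ : BOp h} (hρ : IsState ρ) :
    IsHilbertSchmidt (CFC.sqrt ρ) := by
  have hsa : IsSelfAdjoint (CFC.sqrt ρ) := (CFC.sqrt_nonneg ρ).isSelfAdjoint
  refine Complex.summable_ofReal.1 (hρ.trace_one.summable.congr fun i => ?_)
  nth_rw 1 [← CFC.sqrt_mul_sqrt_self ρ hρ.nonneg]
  rw [mul_apply_eq_comp, ← ContinuousLinearMap.adjoint_inner_left,
    ← ContinuousLinearMap.star_eq_adjoint, hsa.star_eq, inner_self_eq_norm_sq_to_K,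
    Complex.ofReal_pow]
  rfl

/-- The kernel of `ρ^{1/2}` is trivial, as `tr (ρ |u⟩⟨u|) = 0` for `u` in it. -/
theorem IsFaithful.denseRange_sqrt {ρ : BOp h} (hρ : IsState ρ) (hρf : IsFaithful ρ) :
    DenseRange ((CFC.sqrt ρ : BOp h) : h → h) := by
  have hsa : IsSelfAdjoint (CFC.sqrt ρ) := (CFC.sqrt_nonneg ρ).isSelfAdjoint
  have hker : ∀ u, CFC.sqrt ρ u = 0 → u = 0 := by
    intro u hu
    have h1 : ρ * InnerProductSpace.rankOne ℂ u u = 0 := by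
      ext w
      rw [mul_apply_eq_comp, InnerProductSpace.rankOne_apply, map_smul,
        ← CFC.sqrt_mul_sqrt_self ρ hρ.nonneg, mul_apply_eq_comp, hu]
      simp
    have h2 := hρf _ ((ContinuousLinearMap.nonneg_iff_isPositive _).2
      (InnerProductSpace.isPositive_rankOne_self u)) (by rw [h1]; simp [opTrace])
    have h3 : ‖u‖ * ‖u‖ = 0 := by
      rw [← InnerProductSpace.norm_rankOne (𝕜 := ℂ), h2, norm_zero]
    simpa using h3
  have h4 : (LinearMap.range (CFC.sqrt ρ).toLinearMap)ᗮ = ⊥ := by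
    rw [ContinuousLinearMap.orthogonal_range, ← ContinuousLinearMap.star_eq_adjoint, hsa.star_eq]
    exact LinearMap.ker_eq_bot'.2 hker
  have h5 := (Submodule.topologicalClosure_eq_top_iff).2 h4
  have h6 := (Submodule.dense_iff_topologicalClosure_eq_top).2 h5
  rwa [LinearMap.coe_range] at h6

/-! ### The adjoint of the generator and its exponential -/

/-- A map with an adjoint for the KMS form has a closed graph. -/
theorem continuous_of_kmsAdjoint {s : BOp h} (hs : IsHilbertSchmidt s) (hsa : IsSelfAdjoint s)
    (hd : DenseRange s) {f g : BOp h →ₗ[ℂ] BOp h}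
    (hfg : ∀ x y, kmsForm s hs (f x) y = kmsForm s hs x (g y)) : Continuous f := by
  refine f.continuous_of_seq_closed_graph fun u x z hu hz => eq_of_kmsForm_eq hs hsa hd fun y => ?_
  rw [hfg]
  refine tendsto_nhds_unique (((continuous_kmsForm_left s hs y).tendsto z).comp hz) ?_
  simp only [Function.comp_def, hfg]
  exact ((continuous_kmsForm_left s hs (g y)).tendsto x).comp hu

theorem kmsForm_exp {s : BOp h} (hs : IsHilbertSchmidt s) {f g : BOp h →L[ℂ] BOp h}
    (hfg : ∀ x y, kmsForm s hs (f x) y = kmsForm s hs x (g y)) (x y : BOp h) :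
    kmsForm s hs (NormedSpace.exp f x) y = kmsForm s hs x (NormedSpace.exp g y) := by
  have hpow : ∀ (n : ℕ) x y, kmsForm s hs ((f ^ n) x) y = kmsForm s hs x ((g ^ n) y) := by
    intro n
    induction n with
    | zero => intro x y; rfl
    | succ n ih =>
      intro x y
      rw [pow_succ, pow_succ', mul_apply_eq_comp, mul_apply_eq_comp, ih, hfg]
  have h1 := ((NormedSpace.exp_series_hasSum_exp' (𝕂 := ℂ) f).mapL
    (ContinuousLinearMap.apply ℂ (BOp h) x)).map ((kmsForm s hs).flip y)
      (continuous_kmsForm_left s hs y)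
  have h2 := ((NormedSpace.exp_series_hasSum_exp' (𝕂 := ℂ) g).mapL
    (ContinuousLinearMap.apply ℂ (BOp h) y)).map (kmsForm s hs x)
      (continuous_kmsForm_right s hs x)
  refine h1.unique ?_
  convert! h2 using 1
  funext n
  simp only [Function.comp_apply, ContinuousLinearMap.apply_apply, map_smul,
    LinearMap.flip_apply, hpow]

/-! ### The adjoint semigroup -/

theorem IsQMS.nonneg_map {T : ℝ≥0 → (BOp h →L[ℂ] BOp h)} (hT : IsQMS T) (t : ℝ≥0) {x : BOp h}
    (hx : 0 ≤ x) : 0 ≤ T t x := by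
  obtain ⟨φ, hφ⟩ := hT.completelyPositive t
  rw [← hφ]
  exact map_nonneg φ hx

theorem IsQMS.nonneg_map_cstarMatrix {T : ℝ≥0 → (BOp h →L[ℂ] BOp h)} (hT : IsQMS T) (t : ℝ≥0)
    {k : ℕ} {X : CStarMatrix (Fin k) (Fin k) (BOp h)} (hX : 0 ≤ X) : 0 ≤ X.map (T t) := by
  obtain ⟨φ, hφ⟩ := hT.completelyPositive t
  rw [← funext hφ]
  exact φ.map_cstarMatrix_nonneg X hX

theorem exists_completelyPositiveMap {f : BOp h →L[ℂ] BOp h}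
    (hf : ∀ (k : ℕ) (X : CStarMatrix (Fin k) (Fin k) (BOp h)), 0 ≤ X → 0 ≤ X.map f) :
    ∃ φ : BOp h →CP BOp h, ∀ x, φ x = f x :=
  ⟨⟨f.toLinearMap, hf⟩, fun _ => rfl⟩

/-- A uniformly continuous semigroup `T'` in duality with `T` inherits complete positivity,
normality and, by invariance of `ρ`, the unit from `T`. -/
theorem isQMS_of_kmsAdjoint {ρ : BOp h} (hρ : IsState ρ) (hρf : IsFaithful ρ)
    {T T' : ℝ≥0 → (BOp h →L[ℂ] BOp h)} (hT : IsQMS T) (hρT : IsInvariant ρ T)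
    (h0 : T' 0 = 1) (hadd : ∀ s t, T' (s + t) = T' s * T' t) (hc : Continuous T')
    (hdual : ∀ t x y, kmsForm (CFC.sqrt ρ) hρ.isHilbertSchmidt_sqrt (T' t x) y =
      kmsForm (CFC.sqrt ρ) hρ.isHilbertSchmidt_sqrt x (T t y)) : IsQMS T' where
  map_zero := h0
  map_add := hadd
  map_one t := by
    refine eq_of_kmsForm_eq hρ.isHilbertSchmidt_sqrt (CFC.sqrt_nonneg ρ).isSelfAdjoint
      (hρf.denseRange_sqrt hρ) fun y => ?_
    rw [hdual, kmsForm_apply, kmsForm_apply, mul_one, CFC.sqrt_mul_sqrt_self ρ hρ.nonneg, hρT]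
  completelyPositive t := exists_completelyPositiveMap fun _ _ hX =>
    nonneg_map_cstarMatrix_of_kmsAdjoint (f := (T' t).toLinearMap) (g := (T t).toLinearMap)
      hρ.isHilbertSchmidt_sqrt (CFC.sqrt_nonneg ρ).isSelfAdjoint (hρf.denseRange_sqrt hρ)
      (hdual t) (fun _ _ hY => hT.nonneg_map_cstarMatrix t hY) (fun _ hy => hT.nonneg_map t hy) hX
  normal t := scottContinuous_of_kmsAdjoint (f := (T' t).toLinearMap) (g := (T t).toLinearMap)
      hρ.isHilbertSchmidt_sqrt (CFC.sqrt_nonneg ρ).isSelfAdjoint (hρf.denseRange_sqrt hρ)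
      (hdual t) (fun _ hy => hT.nonneg_map t hy)
  weakContinuous x _ _ hu hv := (continuous_tsum_inner hu hv).comp (hc.clm_apply continuous_const)

/-! ### Conjugation with the reversing operation -/

theorem reversing_add (θ : h ≃ₗᵢ⋆[ℂ] h) (x y : BOp h) :
    reversing θ (x + y) = reversing θ x + reversing θ y := by
  ext u
  simp only [reversing_apply, star_add, add_apply, map_add]

theorem reversing_smul (θ : h ≃ₗᵢ⋆[ℂ] h) (c : ℂ) (x : BOp h) :
    reversing θ (c • x) = c • reversing θ x := by
  ext u
  rw [reversing_apply, star_smul, smul_apply, θ.map_smulₛₗ, smul_apply, reversing_apply]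
  simp

theorem norm_reversing_le (θ : h ≃ₗᵢ⋆[ℂ] h) (x : BOp h) : ‖reversing θ x‖ ≤ ‖x‖ := by
  refine ContinuousLinearMap.opNorm_le_bound _ (norm_nonneg _) fun u => ?_
  rw [reversing_apply, θ.norm_map]
  refine ((star x).le_opNorm _).trans_eq ?_
  rw [norm_star, θ.norm_map]

/-- The reversing operation as a continuous linear map. -/
noncomputable def reversingL (θ : h ≃ₗᵢ⋆[ℂ] h) : BOp h →L[ℂ] BOp h :=
  LinearMap.mkContinuous ⟨⟨reversing θ, reversing_add θ⟩, reversing_smul θ⟩ 1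
    fun x => (norm_reversing_le θ x).trans_eq (one_mul _).symm

theorem reversingL_apply (θ : h ≃ₗᵢ⋆[ℂ] h) (x : BOp h) : reversingL θ x = reversing θ x := rfl

theorem inner_reversing {θ : h ≃ₗᵢ⋆[ℂ] h} (hθ : ∀ u, θ (θ u) = u) (x : BOp h) (u v : h) :
    ⟪u, reversing θ x v⟫_ℂ = ⟪θ v, x (θ u)⟫_ℂ := by
  conv_lhs => rw [← hθ u, reversing_apply, antiunitary_inner]
  exact ContinuousLinearMap.adjoint_inner_left x _ _

theorem star_reversing {θ : h ≃ₗᵢ⋆[ℂ] h} (hθ : ∀ u, θ (θ u) = u) (x : BOp h) :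
    star (reversing θ x) = reversing θ (star x) := by
  rw [ContinuousLinearMap.star_eq_adjoint, eq_comm, ContinuousLinearMap.eq_adjoint_iff]
  intro u v
  rw [inner_reversing hθ, ← inner_conj_symm, inner_reversing hθ, inner_conj_symm,
    ContinuousLinearMap.star_eq_adjoint, ContinuousLinearMap.adjoint_inner_left]

theorem reversing_reversing {θ : h ≃ₗᵢ⋆[ℂ] h} (hθ : ∀ u, θ (θ u) = u) (x : BOp h) :
    reversing θ (reversing θ x) = x := by
  ext u
  rw [reversing_apply, star_reversing hθ, reversing_apply, star_star, hθ, hθ]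

theorem reversing_mul {θ : h ≃ₗᵢ⋆[ℂ] h} (hθ : ∀ u, θ (θ u) = u) (x y : BOp h) :
    reversing θ (x * y) = reversing θ y * reversing θ x := by
  ext u
  rw [reversing_apply, star_mul, mul_apply_eq_comp, mul_apply_eq_comp, reversing_apply,
    reversing_apply, hθ]

theorem reversing_one {θ : h ≃ₗᵢ⋆[ℂ] h} (hθ : ∀ u, θ (θ u) = u) :
    reversing θ (1 : BOp h) = 1 := by
  ext u
  rw [reversing_apply, star_one, one_apply_eq_self, hθ, one_apply_eq_self]

theorem reversing_nonneg {θ : h ≃ₗᵢ⋆[ℂ] h} (hθ : ∀ u, θ (θ u) = u) {x : BOp h} (hx : 0 ≤ x) :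
    0 ≤ reversing θ x :=
  nonneg_of_forall_inner_nonneg fun u => by
    rw [inner_reversing hθ]
    exact inner_nonneg_of_nonneg hx _

theorem scottContinuous_of_monotone_of_involutive {α : Type*} [Preorder α] {f : α → α}
    (hf : Monotone f) (hinv : Function.Involutive f) : ScottContinuous f := by
  refine fun d _ _ a ha => ⟨hf.mem_upperBounds_image ha.1, fun b hb => ?_⟩
  rw [← hinv b]
  exact hf (ha.2 fun x hx => by
    rw [← hinv x]
    exact hf (hb (Set.mem_image_of_mem f hx)))

theorem scottContinuous_reversing {θ : h ≃ₗᵢ⋆[ℂ] h} (hθ : ∀ u, θ (θ u) = u) :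
    ScottContinuous (reversing θ) := by
  refine scottContinuous_of_monotone_of_involutive (fun x y hxy => ?_) (reversing_reversing hθ)
  rw [← sub_nonneg, ← reversingL_apply, ← reversingL_apply, ← map_sub]
  exact reversing_nonneg hθ (sub_nonneg.2 hxy)

/-- The map `x ↦ Θ(x*) = θ x θ` is multiplicative, unlike `Θ`, and therefore preserves the
positivity of matrices. -/
theorem nonneg_map_reversing_star {θ : h ≃ₗᵢ⋆[ℂ] h} (hθ : ∀ u, θ (θ u) = u) {k : ℕ}
    {X : CStarMatrix (Fin k) (Fin k) (BOp h)} (hX : 0 ≤ X) :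
    0 ≤ X.map fun x => reversing θ (star x) := by
  obtain ⟨Z, rfl⟩ := exists_eq_star_mul_self hX
  have h1 : (star Z * Z).map (fun x => reversing θ (star x)) =
      star (Z.map fun x => reversing θ (star x)) * Z.map fun x => reversing θ (star x) := by
    ext i j : 1
    simp only [CStarMatrix.map_apply, CStarMatrix.mul_apply, CStarMatrix.star_apply]
    rw [star_sum, ← reversingL_apply, map_sum]
    refine Finset.sum_congr rfl fun l _ => ?_
    rw [reversingL_apply, star_mul, star_star, reversing_mul hθ, star_reversing hθ, star_star]
  rw [h1]
  exact star_mul_self_nonneg _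

/-- Complete positivity of `Θ T_t Θ` follows from `Θ(T_t(Θ(x))) = j(T_t(j(x)))` with
`j(x) = Θ(x*)`. -/
theorem IsQMS.conj_reversing {θ : h ≃ₗᵢ⋆[ℂ] h} (hθ : ∀ u, θ (θ u) = u)
    {T : ℝ≥0 → (BOp h →L[ℂ] BOp h)} (hT : IsQMS T) :
    IsQMS fun t => (reversingL θ).comp ((T t).comp (reversingL θ)) where
  map_zero := by
    ext1 x
    simp only [hT.map_zero]
    exact reversing_reversing hθ x
  map_add s t := by
    ext1 x
    simp only [hT.map_add, ContinuousLinearMap.comp_apply, reversingL_apply,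
      reversing_reversing hθ]
  map_one t := by
    simp only [ContinuousLinearMap.comp_apply, reversingL_apply, reversing_one hθ, hT.map_one]
  completelyPositive t := exists_completelyPositiveMap fun k X hX => by
    have hstar : ∀ x, T t (star x) = star (T t x) :=
      map_star_of_forall_nonneg (f := (T t).toLinearMap) fun x hx => hT.nonneg_map t hx
    have h1 := nonneg_map_reversing_star hθ
      (hT.nonneg_map_cstarMatrix t (nonneg_map_reversing_star hθ hX))
    convert! h1 using 1
    ext i j : 1
    simp only [CStarMatrix.map_apply, ContinuousLinearMap.comp_apply, reversingL_apply]
    rw [← hstar, star_reversing hθ, star_star]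
  normal t := (scottContinuous_reversing hθ).comp
    ((hT.normal t).comp (scottContinuous_reversing hθ))
  weakContinuous x u v hu hv := by
    simp only [ContinuousLinearMap.comp_apply, reversingL_apply, inner_reversing hθ]
    exact hT.weakContinuous _ _ _ (by simpa using hv) (by simpa using hu)

end KMS

theorem mainTheorem11 {h : Type*} [NormedAddCommGroup h] [InnerProductSpace ℂ h] [CompleteSpace h]
    [TopologicalSpace.SeparableSpace h]
    (θ : h ≃ₗᵢ⋆[ℂ] h) (hθ : ∀ u, θ (θ u) = u)
    (T : ℝ≥0 → (KMS.BOp h →L[ℂ] KMS.BOp h)) (hT : KMS.IsQMS T)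
    (hTc : KMS.IsUniformlyContinuous T)
    (ρ : KMS.BOp h) (hρ : KMS.IsState ρ) (hρf : KMS.IsFaithful ρ) (hρT : KMS.IsInvariant ρ T)
    (hwdb : KMS.WeightedDetailedBalance ρ T) :
    ∃ T' TΘ : ℝ≥0 → (KMS.BOp h →L[ℂ] KMS.BOp h),
      (KMS.IsKMSAdjointQMS ρ T T' ∧ ∀ S, KMS.IsKMSAdjointQMS ρ T S → S = T') ∧
      (KMS.IsThetaKMSAdjointQMS θ ρ T TΘ ∧ ∀ S, KMS.IsThetaKMSAdjointQMS θ ρ T S → S = TΘ) ∧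
      (∀ t x, TΘ t x = KMS.reversing θ (T' t (KMS.reversing θ x))) ∧
      KMS.IsUniformlyContinuous TΘ := by
  obtain ⟨𝓛, 𝓛₁, h𝓛, h𝓛₁, -⟩ := hwdb
  have hsa : IsSelfAdjoint (CFC.sqrt ρ) := (CFC.sqrt_nonneg ρ).isSelfAdjoint
  have hs := hρ.isHilbertSchmidt_sqrt
  have hd := hρf.denseRange_sqrt hρ
  have hadj : ∀ x y, KMS.kmsForm (CFC.sqrt ρ) hs (𝓛₁ x) y =
      KMS.kmsForm (CFC.sqrt ρ) hs x (𝓛 y) := fun x y => (h𝓛₁ x y).symm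
  let 𝓛' : KMS.BOp h →L[ℂ] KMS.BOp h :=
    ⟨𝓛₁, KMS.continuous_of_kmsAdjoint (g := 𝓛.toLinearMap) hs hsa hd hadj⟩
  let T' : ℝ≥0 → (KMS.BOp h →L[ℂ] KMS.BOp h) := fun t =>
    NormedSpace.exp (((t : ℝ) : ℂ) • 𝓛')
  have hTexp : ∀ t, T t = NormedSpace.exp (((t : ℝ) : ℂ) • 𝓛) :=
    semigroup_eq_exp hT.map_zero hT.map_add (tendsto_iff_norm_sub_tendsto_zero.2 hTc) h𝓛
  have hdual : ∀ t x y, KMS.kmsForm (CFC.sqrt ρ) hs (T' t x) y =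
      KMS.kmsForm (CFC.sqrt ρ) hs x (T t y) := fun t x y => by
    rw [hTexp]
    refine KMS.kmsForm_exp hs (fun x y => ?_) x y
    rw [smul_apply, smul_apply, map_smul, map_smul, LinearMap.smul_apply]
    exact congrArg _ (hadj x y)
  have h0 : T' 0 = 1 := exp_semigroup_zero 𝓛'
  have hadd : ∀ s t, T' (s + t) = T' s * T' t := exp_semigroup_add 𝓛'
  have hc : Continuous T' := continuous_exp_semigroup 𝓛'
  have hT' : KMS.IsQMS T' := KMS.isQMS_of_kmsAdjoint hρ hρf hT hρT h0 hadd hc hdual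
  refine ⟨T', fun t => (KMS.reversingL θ).comp ((T' t).comp (KMS.reversingL θ)),
    ⟨⟨hT', fun t x y => (hdual t x y).symm⟩, fun S hS => ?_⟩,
    ⟨⟨hT'.conj_reversing hθ, fun t x y => ?_⟩, fun S hS => ?_⟩, fun t x => rfl, ?_⟩
  · funext t
    ext1 x
    refine KMS.eq_of_kmsForm_eq hs hsa hd fun y => ?_
    rw [hdual]
    exact (hS.duality t x y).symm
  · simp only [ContinuousLinearMap.comp_apply, KMS.reversingL_apply, KMS.reversing_reversing hθ]
    exact (hdual t _ y).symm
  · funext t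
    ext1 x
    have h1 : KMS.reversing θ (S t x) = T' t (KMS.reversing θ x) := by
      refine KMS.eq_of_kmsForm_eq hs hsa hd fun y => ?_
      rw [hdual]
      have := hS.duality t (star x) y
      rw [star_star] at this
      exact this.symm
    rw [ContinuousLinearMap.comp_apply, ContinuousLinearMap.comp_apply, KMS.reversingL_apply,
      KMS.reversingL_apply, ← h1, KMS.reversing_reversing hθ]
  · have hlim : Tendsto T' (𝓝 0) (𝓝 1) := h0 ▸ hc.tendsto 0
    have hcomp : Continuous fun A : KMS.BOp h →L[ℂ] KMS.BOp h =>
        (KMS.reversingL θ).comp (A.comp (KMS.reversingL θ)) := by fun_prop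
    have hid : (KMS.reversingL θ).comp
        ((1 : KMS.BOp h →L[ℂ] KMS.BOp h).comp (KMS.reversingL θ)) =
        ContinuousLinearMap.id ℂ (KMS.BOp h) := by
      ext1 x
      exact KMS.reversing_reversing hθ x
    have := (hcomp.tendsto 1).comp hlim
    rw [hid] at this
    exact tendsto_iff_norm_sub_tendsto_zero.1 this
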